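/- For real $x\ge 16$ write $\log_2 x=\log\log x$ and $\log_3 x=\log\log\log x$. Let $G$ be an abelian group. For a finitely supported $G$-valued random variable $X$ let $\mathbb H(X)=\sum_x \mathbb P(X=x)\log\frac1{\mathbb P(X=x)}$ be its Shannon entropy, and let $nX$ denote the sum of $n$ independent copies of $X$. For two such variables let $d[X;Y]=\mathbb H(X'-Y')-\frac12\mathbb H(X)-\frac12\mathbb H(Y)$, where $X',Y'$ are independent copies of $X,Y$. Say that $X$ has polynomial growth of order $d$ at scale $N$ if $\mathbb H(nX)\le \mathbb H(X)+d\log n$ for all positive integers $n\le N$. There are an absolute constant $c>0$ and a function $d:[1,\infty)\to(0,\infty)$ with $d(K)\le c\,\log(16K)\log_3(16K)$ for all $K\ge1$, such that for every real $C$ there is $K_0$, depending only on $C$, with the following property. Let $A$ be a finite nonempty subset of an abelian group $G$ with $|A+A|\le K|A|$, let $U_A$ be uniformly distributed on $A$, put $\eta=1/1009$, and let $(X,Y)$ minimize \[\tau[X;Y]=d[X;Y]+\frac{\eta}{\log_2(16K)\log_3(16K)}\bigl(d[X;U_A]+d[Y;U_A]\bigr)\] over all pairs of random variables supported on $A$.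 Write $d=d(K)$. Then either $K\le K_0$, or $X$ has polynomial growth of order $d$ at scale $Cd^5$. Moreover, $d[X;U_A]\le 30\,d\log d$. -/

import Mathlib

open scoped Pointwise

universe u

namespace EntropicGrowth

noncomputable section

/-- The iterated logarithm `log log x`. -/
def log₂ (x : ℝ) : ℝ := Real.log (Real.log x)

/-- The iterated logarithm `log log log x`. -/
def log₃ (x : ℝ) : ℝ := Real.log (Real.log (Real.log x))

/- A `G`-valued (discrete) random variable enters all notions below only through its law, so it is
represented by its law, a probability mass function on `G`. -/

/-- The Shannon entropy `∑ x, p(x) log (1 / p(x))` of a random variable with law `p`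
(used for finitely supported `p` only). The summand is `0` where `p x = 0`. -/
def entropy {G : Type u} (p : PMF G) : ℝ :=
  ∑' x, Real.negMulLog (p x).toReal

/-- The law of `X + Y`, where `X` and `Y` are independent with laws `p` and `q`. -/
def indepAdd {G : Type u} [AddCommGroup G] (p q : PMF G) : PMF G :=
  p.bind fun x => q.map fun y => x + y

/-- The law of `X - Y`, where `X` and `Y` are independent with laws `p` and `q`. -/
def indepSub {G : Type u} [AddCommGroup G] (p q : PMF G) : PMF G :=
  p.bind fun x => q.map fun y => x - y

/-- The law of `nX`, the sum of `n` independent copies of a random variable `X` with law `p`. -/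
def iidSum {G : Type u} [AddCommGroup G] (p : PMF G) : ℕ → PMF G
  | 0 => PMF.pure 0
  | n + 1 => indepAdd (iidSum p n) p

/-- The entropic Ruzsa distance `d[X;Y] = H(X' - Y') - H(X)/2 - H(Y)/2`, where `X'` and `Y'` are
independent copies of `X` and `Y`. -/
def ruzsaDist {G : Type u} [AddCommGroup G] (p q : PMF G) : ℝ :=
  entropy (indepSub p q) - entropy p / 2 - entropy q / 2

/-- (Entropic) polynomial growth of order `d` at scale `N`:
`H(nX) ≤ H(X) + d log n` for all positive integers `n ≤ N`. -/
def HasPolynomialGrowth {G : Type u} [AddCommGroup G] (p : PMF G) (d N : ℝ) : Prop :=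
  ∀ n : ℕ, 0 < n → (n : ℝ) ≤ N → entropy (iidSum p n) ≤ entropy p + d * Real.log n

/-- The functional
`τ[X;Y] = d[X;Y] + η / (log₂(16K) log₃(16K)) * (d[X;U_A] + d[Y;U_A])` with `η = 1/1009`, where
`U_A` is uniformly distributed on `A`. -/
def tau {G : Type u} [AddCommGroup G] (A : Finset G) (hA : A.Nonempty) (K : ℝ)
    (p q : PMF G) : ℝ :=
  ruzsaDist p q + (1 / 1009) / (log₂ (16 * K) * log₃ (16 * K)) *
    (ruzsaDist p (PMF.uniformOfFinset A hA) + ruzsaDist q (PMF.uniformOfFinset A hA))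

/-- `(p, q)` minimizes `τ` among all pairs of (laws of) random variables supported on `A`. -/
def IsTauMinimizer {G : Type u} [AddCommGroup G] (A : Finset G) (hA : A.Nonempty) (K : ℝ)
    (p q : PMF G) : Prop :=
  p.support ⊆ (A : Set G) ∧ q.support ⊆ (A : Set G) ∧
    ∀ p' q' : PMF G, p'.support ⊆ (A : Set G) → q'.support ⊆ (A : Set G) →
      tau A hA K p q ≤ tau A hA K p' q'

end

end EntropicGrowth

open EntropicGrowth

/-! Write k = d[X;Y] and e = η/(log₂(16K) log₃(16K)). For R, T independent of the minimizer, the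
fibring inequality bounds d[X+R;Y+T] plus the mean distance between X given X+R and Y given Y+T. The
conditional laws still live on A, so minimality bounds that mean below; concavity controls the
distances to U_A. The result (`ruzsaDist_add_le`) says exactly that d[R;T] - (e/2)(H(R)+H(T)) does
not increase when X is added to R and Y to T.

Applied repeatedly with sign changes and swaps, this leads from (X, Y) to (nD, -nD), where D = X - Y
(`reducedDist_nsmul_le`). Since d[Z;-Z] = H(2Z) - H(Z), each doubling of n multiplies the entropy of
nD by at most 1+e and adds a controlled multiple of k. While log n is of order at most 1/e, the
factor (1+e)^j stays bounded and H(nX) ≤ H(X) + O(k log n) (`entropy_nsmul_le`). At scale C d^5, log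
n is O(log₂(16K)), which this range allows.

Comparison with (U_A, U_A) and Ruzsa's triangle inequality give k = O(log K) and the bound on
d[X;U_A] (`IsTauMinimizer.bounds`). -/

namespace EntropicGrowth

noncomputable section

variable {α β ι : Type*}

/-! ### Expectations and entropies of finitely supported laws -/

/-- The expectation `∑ i, p(i) g(i)` of a function of a random variable with law `p`. -/
def expect (p : PMF ι) (g : ι → ℝ) : ℝ := ∑' i, (p i).toReal * g i

lemma apply_eq_zero_of_support_subset {p : PMF ι} {s : Finset ι} (h : p.support ⊆ s) {i : ι}
    (hi : i ∉ s) : p i = 0 := by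
  by_contra h0
  exact hi (h ((p.mem_support_iff i).2 h0))

lemma expect_eq_sum {p : PMF ι} {s : Finset ι} (h : p.support ⊆ s) (g : ι → ℝ) :
    expect p g = ∑ i ∈ s, (p i).toReal * g i :=
  tsum_eq_sum fun i hi => by simp [apply_eq_zero_of_support_subset h hi]

lemma entropy_eq_sum {p : PMF α} {s : Finset α} (h : p.support ⊆ s) :
    entropy p = ∑ i ∈ s, Real.negMulLog (p i).toReal :=
  tsum_eq_sum fun i hi => by simp [apply_eq_zero_of_support_subset h hi]

lemma sum_toReal_eq_one {p : PMF ι} {s : Finset ι} (h : p.support ⊆ s) :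
    ∑ i ∈ s, (p i).toReal = 1 := by
  have hs : ∑' i, p i = ∑ i ∈ s, p i :=
    tsum_eq_sum fun i hi => apply_eq_zero_of_support_subset h hi
  rw [← ENNReal.toReal_sum fun i _ => p.apply_ne_top i, ← hs, p.tsum_coe, ENNReal.toReal_one]

lemma toReal_bind_apply {p : PMF ι} {s : Finset ι} (h : p.support ⊆ s) (f : ι → PMF α) (x : α) :
    (p.bind f x).toReal = ∑ i ∈ s, (p i).toReal * (f i x).toReal := by
  rw [PMF.bind_apply,
    tsum_eq_sum (s := s) fun i hi => by simp [apply_eq_zero_of_support_subset h hi],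
    ENNReal.toReal_sum fun i _ => ENNReal.mul_ne_top (p.apply_ne_top i) ((f i).apply_ne_top x)]
  simp [ENNReal.toReal_mul]

lemma support_subset_support_bind {p : PMF ι} (f : ι → PMF α) {i : ι} (hi : p i ≠ 0) :
    (f i).support ⊆ (p.bind f).support := by
  intro x hx
  exact (PMF.mem_support_bind_iff p f x).2 ⟨i, (p.mem_support_iff i).2 hi, hx⟩

lemma support_bind_finite {p : PMF ι} {f : ι → PMF α} (hp : p.support.Finite)
    (hf : ∀ i, (f i).support.Finite) : (p.bind f).support.Finite := by
  rw [PMF.support_bind]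
  exact hp.biUnion fun i _ => hf i

lemma support_map_finite {p : PMF ι} (hp : p.support.Finite) (g : ι → α) :
    (p.map g).support.Finite := by
  rw [PMF.support_map]
  exact hp.image g

lemma expect_bind {p : PMF ι} {f : ι → PMF α} (hp : p.support.Finite)
    (hb : (p.bind f).support.Finite) (g : α → ℝ) :
    expect (p.bind f) g = expect p fun i => expect (f i) g := by
  rw [expect_eq_sum (s := hb.toFinset) (by simp), expect_eq_sum (s := hp.toFinset) (by simp)]
  simp_rw [toReal_bind_apply (s := hp.toFinset) (p := p) (by simp), Finset.sum_mul]
  rw [Finset.sum_comm]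
  refine Finset.sum_congr rfl fun i hi => ?_
  have hi' : p i ≠ 0 := by simpa using hi
  rw [expect_eq_sum (s := hb.toFinset) (by simpa using support_subset_support_bind f hi'),
    Finset.mul_sum]
  exact Finset.sum_congr rfl fun x _ => mul_assoc _ _ _

lemma expect_map {p : PMF ι} (hp : p.support.Finite) (f : ι → α) (g : α → ℝ) :
    expect (p.map f) g = expect p fun i => g (f i) := by
  rw [← PMF.bind_pure_comp, expect_bind hp (support_bind_finite hp fun i => by simp)]
  congr 1
  ext i
  rw [Function.comp_apply, expect_eq_sum (s := {f i}) (by simp)]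
  simp

lemma expect_const {p : PMF ι} (hp : p.support.Finite) (c : ℝ) : (expect p fun _ => c) = c := by
  rw [expect_eq_sum (s := hp.toFinset) (by simp), ← Finset.sum_mul,
    sum_toReal_eq_one (by simp), one_mul]

lemma expect_add {p : PMF ι} (hp : p.support.Finite) (f g : ι → ℝ) :
    (expect p fun i => f i + g i) = expect p f + expect p g := by
  simp only [expect_eq_sum (s := hp.toFinset) (p := p) (by simp), mul_add, Finset.sum_add_distrib]

lemma expect_const_mul {p : PMF ι} (c : ℝ) (f : ι → ℝ) :
    (expect p fun i => c * f i) = c * expect p f := by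
  simp only [expect, ← tsum_mul_left, mul_left_comm]

lemma expect_mono {p : PMF ι} (hp : p.support.Finite) {f g : ι → ℝ}
    (h : ∀ i ∈ p.support, f i ≤ g i) : expect p f ≤ expect p g := by
  simp only [expect_eq_sum (s := hp.toFinset) (p := p) (by simp)]
  exact Finset.sum_le_sum fun i hi =>
    mul_le_mul_of_nonneg_left (h i (by simpa using hi)) ENNReal.toReal_nonneg

/-- Entropy is concave. -/
lemma expect_entropy_le_entropy_bind {p : PMF ι} {f : ι → PMF α} (hp : p.support.Finite)
    (hb : (p.bind f).support.Finite) :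
    (expect p fun i => entropy (f i)) ≤ entropy (p.bind f) := by
  rw [entropy_eq_sum (s := hb.toFinset) (by simp), expect_eq_sum (s := hp.toFinset) (by simp)]
  calc ∑ i ∈ hp.toFinset, (p i).toReal * entropy (f i)
      = ∑ i ∈ hp.toFinset, ∑ x ∈ hb.toFinset, (p i).toReal * Real.negMulLog (f i x).toReal := by
        refine Finset.sum_congr rfl fun i hi => ?_
        have hi' : p i ≠ 0 := by simpa using hi
        rw [entropy_eq_sum (s := hb.toFinset)
          (by simpa using support_subset_support_bind f hi'), Finset.mul_sum]
    _ = ∑ x ∈ hb.toFinset, ∑ i ∈ hp.toFinset, (p i).toReal * Real.negMulLog (f i x).toReal :=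
        Finset.sum_comm
    _ ≤ _ := by
        refine Finset.sum_le_sum fun x _ => ?_
        rw [toReal_bind_apply (s := hp.toFinset) (by simp)]
        exact Real.concaveOn_negMulLog.le_map_sum (fun i _ => ENNReal.toReal_nonneg)
          (sum_toReal_eq_one (by simp)) (fun i _ => ENNReal.toReal_nonneg)

/-- The chain rule for entropy. -/
lemma entropy_bind_of_fibers {p : PMF ι} {f : ι → PMF α} (hp : p.support.Finite)
    (hb : (p.bind f).support.Finite) (g : α → ι)
    (hg : ∀ i ∈ p.support, ∀ x ∈ (f i).support, g x = i) :
    entropy (p.bind f) = entropy p + expect p fun i => entropy (f i) := by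
  classical
  -- A point `x` can only come from the index `g x`, so the mixture has at most one nonzero term and
  -- `negMulLog` passes through the sum.
  have hterm : ∀ x, Real.negMulLog (p.bind f x).toReal =
      ∑ i ∈ hp.toFinset, Real.negMulLog ((p i).toReal * (f i x).toReal) := by
    intro x
    have hz : ∀ i ∈ hp.toFinset, i ≠ g x → f i x = 0 := by
      intro i hi hne
      by_contra h0
      exact hne (hg i (by simpa using hi) x (((f i).mem_support_iff x).2 h0)).symm
    have hz' : g x ∉ hp.toFinset → p (g x) = 0 := by simp
    rw [toReal_bind_apply (s := hp.toFinset) (by simp),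
      Finset.sum_eq_single (g x) (fun i hi hne => by simp [hz i hi hne])
        (fun h => by simp [hz' h]),
      Finset.sum_eq_single (g x) (fun i hi hne => by simp [hz i hi hne])
        (fun h => by simp [hz' h])]
  rw [entropy_eq_sum (s := hb.toFinset) (by simp), entropy_eq_sum (s := hp.toFinset) (by simp),
    expect_eq_sum (s := hp.toFinset) (by simp), ← Finset.sum_add_distrib]
  simp_rw [hterm]
  rw [Finset.sum_comm]
  refine Finset.sum_congr rfl fun i hi => ?_
  have hi' : p i ≠ 0 := by simpa using hi
  have hsub : (f i).support ⊆ (hb.toFinset : Set α) := by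
    simpa using support_subset_support_bind f hi'
  simp_rw [Real.negMulLog_mul, Finset.sum_add_distrib, ← Finset.sum_mul, ← Finset.mul_sum]
  rw [sum_toReal_eq_one hsub, entropy_eq_sum hsub, one_mul]

lemma entropy_pure (a : α) : entropy (PMF.pure a) = 0 := by
  rw [entropy_eq_sum (s := {a}) (by simp)]
  simp

/-- The image law is a mixture of point masses, of entropy zero, and a left inverse on the support
recovers the index: the chain rule applies. -/
lemma entropy_map_of_injOn {p : PMF α} (hp : p.support.Finite) {f : α → β}
    (hf : Set.InjOn f p.support) : entropy (p.map f) = entropy p := by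
  have : Nonempty α := ⟨p.support_nonempty.some⟩
  rw [← PMF.bind_pure_comp, entropy_bind_of_fibers hp (support_bind_finite hp fun i => by simp)
    (Function.invFunOn f p.support)]
  · simp [entropy_pure, expect]
  · intro i hi x hx
    obtain rfl : x = f i := by simpa using hx
    exact hf.leftInvOn_invFunOn hi

lemma entropy_map_of_injective {p : PMF α} (hp : p.support.Finite) {f : α → β}
    (hf : Function.Injective f) : entropy (p.map f) = entropy p :=
  entropy_map_of_injOn hp hf.injOn

/-- Jensen for `negMulLog` with equal weights: the probabilities average to `1 / s.card`. -/
lemma entropy_le_log_card {p : PMF α} {s : Finset α} (h : p.support ⊆ s) :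
    entropy p ≤ Real.log s.card := by
  have hs : (0 : ℝ) < s.card := by
    obtain ⟨x, hx⟩ := p.support_nonempty
    exact_mod_cast Finset.card_pos.2 ⟨x, h hx⟩
  have key := Real.concaveOn_negMulLog.le_map_sum (t := s) (w := fun _ => (s.card : ℝ)⁻¹)
    (p := fun i => (p i).toReal) (fun i _ => by positivity)
    (by simp [hs.ne']) (fun i _ => ENNReal.toReal_nonneg)
  simp only [smul_eq_mul, ← Finset.mul_sum, sum_toReal_eq_one h] at key
  rw [← entropy_eq_sum h, mul_one, Real.negMulLog, Real.log_inv] at key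
  have h2 : (s.card : ℝ)⁻¹ * entropy p ≤ (s.card : ℝ)⁻¹ * Real.log s.card := by linarith
  exact le_of_mul_le_mul_left h2 (by positivity)

lemma entropy_uniformOfFinset (A : Finset α) (hA : A.Nonempty) :
    entropy (PMF.uniformOfFinset A hA) = Real.log A.card := by
  have hc : (A.card : ℝ) ≠ 0 := by exact_mod_cast hA.card_pos.ne'
  rw [entropy_eq_sum (s := A) (by simp)]
  rw [Finset.sum_congr rfl (g := fun _ => Real.negMulLog (A.card : ℝ)⁻¹)
    (fun i hi => by simp [hi])]
  simp [Real.negMulLog, hc]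

/-! ### Disintegration -/

lemma bind_congr_support {p : PMF ι} {f g : ι → PMF α} (h : ∀ i ∈ p.support, f i = g i) :
    p.bind f = p.bind g := by
  ext x
  simp only [PMF.bind_apply]
  refine tsum_congr fun i => ?_
  by_cases hi : p i = 0
  · simp [hi]
  · rw [h i ((p.mem_support_iff i).2 hi)]

/-- Every law is the mixture of its conditional laws on the fibers of a map. -/
lemma exists_conditional (p : PMF ι) (g : ι → β) :
    ∃ κ : β → PMF ι, (p.map g).bind κ = p ∧ (∀ b, (κ b).support ⊆ p.support) ∧
      ∀ b ∈ (p.map g).support, ∀ i ∈ (κ b).support, g i = b := by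
  classical
  -- Off the support of the image law there is nothing to condition on; the default `p` has weight
  -- zero there and keeps the support inclusion true for every `b`.
  refine ⟨fun b => if h : ∃ a ∈ {i | g i = b}, a ∈ p.support then p.filter {i | g i = b} h else p,
    ?_, ?_, ?_⟩
  · ext i
    rw [PMF.bind_apply, tsum_eq_single (g i)]
    · by_cases hi : p i = 0
      · rw [hi]
        split_ifs with h
        · simp [PMF.filter_apply, Set.indicator, hi]
        · simp [hi]
      · have h : ∃ a ∈ {j | g j = g i}, a ∈ p.support :=
          ⟨i, rfl, (p.mem_support_iff i).2 hi⟩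
        have hm : (∑' j, Set.indicator {j | g j = g i} p j) = p.map g (g i) := by
          rw [PMF.map_apply]
          refine tsum_congr fun j => ?_
          simp [Set.indicator, eq_comm]
        have h0 : p.map g (g i) ≠ 0 := by
          rw [← PMF.mem_support_iff, PMF.mem_support_map_iff]
          exact ⟨i, (p.mem_support_iff i).2 hi, rfl⟩
        rw [dif_pos h, PMF.filter_apply, hm, Set.indicator_of_mem (by simp), mul_left_comm,
          ENNReal.mul_inv_cancel h0 (PMF.apply_ne_top _ _), mul_one]
    · intro b hb
      split_ifs with h
      · simp [PMF.filter_apply, Set.indicator, hb.symm]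
      · have : p.map g b = 0 := by
          by_contra h0
          obtain ⟨a, ha, hab⟩ := (PMF.mem_support_map_iff _ _ _).1 ((PMF.mem_support_iff _ _).2 h0)
          exact h ⟨a, hab, ha⟩
        simp [this]
  · intro b
    dsimp only
    split_ifs with h
    · rw [PMF.support_filter]
      exact Set.inter_subset_right
    · exact subset_rfl
  · intro b hb i hi
    obtain ⟨a, ha, hab⟩ := (PMF.mem_support_map_iff _ _ _).1 hb
    have h : ∃ a ∈ {i | g i = b}, a ∈ p.support := ⟨a, hab, ha⟩
    simp only [dif_pos h, PMF.support_filter] at hi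
    exact hi.1

/-- Every law on a product is disintegrated by its second marginal. -/
lemma exists_disintegration (μ : PMF (α × β)) :
    ∃ κ : β → PMF α, ((μ.map Prod.snd).bind fun b => (κ b).map fun a => (a, b)) = μ ∧
      ∀ b, (κ b).support ⊆ (μ.map Prod.fst).support := by
  obtain ⟨κ, h1, h2, h3⟩ := exists_conditional μ Prod.snd
  refine ⟨fun b => (κ b).map Prod.fst, ?_, fun b => ?_⟩
  · conv_rhs => rw [← h1]
    refine bind_congr_support fun b hb => ?_
    rw [PMF.map_comp, ← PMF.bind_pure_comp]
    conv_rhs => rw [← PMF.bind_pure (κ b)]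
    refine bind_congr_support fun z hz => ?_
    rw [← h3 b hb z hz]
    rfl
  · rw [PMF.support_map, PMF.support_map]
    exact Set.image_mono (h2 b)

/-- Conditioning on more information decreases entropy: `H(g) + H(F | i) ≤ H(F, g)`. -/
lemma entropy_map_add_expect_le {p : PMF ι} (hp : p.support.Finite) {F : ι → PMF α}
    (hF : ∀ i, (F i).support.Finite) (g : ι → β) :
    entropy (p.map g) + (expect p fun i => entropy (F i)) ≤
      entropy (p.bind fun i => (F i).map fun a => (a, g i)) := by
  obtain ⟨κ, h1, h2, h3⟩ := exists_conditional p g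
  have hσ := support_map_finite hp g
  have hκ : ∀ b, (κ b).support.Finite := fun b => hp.subset (h2 b)
  have hFg : ∀ i, ((F i).map fun a => (a, g i)).support.Finite := fun i =>
    support_map_finite (hF i) _
  have hinj : ∀ i, entropy ((F i).map fun a => (a, g i)) = entropy (F i) := fun i =>
    entropy_map_of_injective (hF i) fun a b h => (Prod.ext_iff.1 h).1
  have hκF : ∀ b, ((κ b).bind fun i => (F i).map fun a => (a, g i)).support.Finite := fun b =>
    support_bind_finite (hκ b) hFg
  have e1 : (p.bind fun i => (F i).map fun a => (a, g i)) =
      (p.map g).bind fun b => (κ b).bind fun i => (F i).map fun a => (a, g i) := by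
    conv_lhs => rw [← h1]
    rw [PMF.bind_bind]
  have e2 : (expect p fun i => entropy (F i)) =
      expect (p.map g) fun b => expect (κ b) fun i => entropy (F i) := by
    conv_lhs => rw [← h1]
    exact expect_bind hσ (by rw [h1]; exact hp) _
  rw [e1, e2, entropy_bind_of_fibers hσ (support_bind_finite hσ hκF) Prod.snd]
  -- After the chain rule for `g`, what remains is concavity inside each fiber; `hinj` attaches the
  -- label `g i` without changing entropies.
  · refine add_le_add_right (expect_mono hσ fun b _ => ?_) _
    rw [← funext hinj]
    exact expect_entropy_le_entropy_bind (hκ b) (hκF b)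
  · intro b hb x hx
    obtain ⟨i, hi, hx⟩ := (PMF.mem_support_bind_iff _ _ _).1 hx
    obtain ⟨a, _, rfl⟩ := (PMF.mem_support_map_iff _ _ _).1 hx
    exact h3 b hb i hi

lemma entropy_prod {p : PMF α} {q : PMF β} (hp : p.support.Finite) (hq : q.support.Finite) :
    entropy (p.bind fun x => q.map fun y => (x, y)) = entropy p + entropy q := by
  rw [entropy_bind_of_fibers hp (support_bind_finite hp fun _ => support_map_finite hq _) Prod.fst]
  · have : ∀ x : α, entropy (q.map fun y => (x, y)) = entropy q := fun x =>
      entropy_map_of_injective hq fun a b h => (Prod.ext_iff.1 h).2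
    simp only [this, expect_const hp]
  · intro x _ z hz
    obtain ⟨y, _, rfl⟩ := (PMF.mem_support_map_iff _ _ _).1 hz
    rfl

/-! ### Convolution of laws on an abelian group -/

section Group

variable {G : Type u} [AddCommGroup G]

instance : Add (PMF G) := ⟨indepAdd⟩

instance : Zero (PMF G) := ⟨PMF.pure 0⟩

/-- Laws on an abelian group form a commutative monoid under convolution. -/
instance : AddCommMonoid (PMF G) where
  add_assoc p q r := by
    change indepAdd (indepAdd p q) r = indepAdd p (indepAdd q r)
    simp [indepAdd, ← PMF.bind_pure_comp, PMF.bind_bind, Function.comp_def, add_assoc]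
  zero_add p := by
    change indepAdd (PMF.pure 0) p = p
    simp [indepAdd, PMF.map, Function.comp_def]
  add_zero p := by
    change indepAdd p (PMF.pure 0) = p
    simp [indepAdd, PMF.map, Function.comp_def]
  add_comm p q := by
    change indepAdd p q = indepAdd q p
    simp only [indepAdd, ← PMF.bind_pure_comp, Function.comp_def]
    rw [PMF.bind_comm]
    simp only [add_comm]
  nsmul := nsmulRec

/-- The law of `-X`, as a homomorphism. -/
def negLaw : PMF G →+ PMF G where
  toFun p := p.map Neg.neg
  map_zero' := (PMF.pure_map Neg.neg (0 : G)).trans (congrArg PMF.pure neg_zero)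
  map_add' p q := by
    change (indepAdd p q).map Neg.neg = indepAdd (p.map Neg.neg) (q.map Neg.neg)
    simp [indepAdd, ← PMF.bind_pure_comp, PMF.bind_bind, Function.comp_def, add_comm]

lemma negLaw_negLaw (p : PMF G) : negLaw (negLaw p) = p := by
  change (p.map Neg.neg).map Neg.neg = p
  rw [PMF.map_comp]
  simp [PMF.map]

lemma indepSub_eq (p q : PMF G) : indepSub p q = p + negLaw q := by
  change _ = indepAdd p (q.map Neg.neg)
  simp [indepSub, indepAdd, PMF.map_comp, Function.comp_def, sub_eq_add_neg]

lemma iidSum_eq_nsmul (p : PMF G) (n : ℕ) : iidSum p n = n • p := by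
  induction n with
  | zero => rw [zero_nsmul]; rfl
  | succ n ih => rw [iidSum, ih, succ_nsmul]; rfl

lemma support_add_finite {p q : PMF G} (hp : p.support.Finite) (hq : q.support.Finite) :
    (p + q).support.Finite :=
  support_bind_finite hp fun _ => support_map_finite hq _

lemma support_negLaw_finite {p : PMF G} (hp : p.support.Finite) : (negLaw p).support.Finite :=
  support_map_finite hp _

lemma support_indepSub_finite {p q : PMF G} (hp : p.support.Finite) (hq : q.support.Finite) :
    (indepSub p q).support.Finite :=
  support_bind_finite hp fun _ => support_map_finite hq _

lemma support_nsmul_finite {p : PMF G} (hp : p.support.Finite) (n : ℕ) :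
    (n • p).support.Finite := by
  induction n with
  | zero =>
    rw [zero_nsmul]
    change (PMF.pure (0 : G)).support.Finite
    simp
  | succ n ih =>
    rw [succ_nsmul]
    exact support_add_finite ih hp

lemma entropy_negLaw {p : PMF G} (hp : p.support.Finite) : entropy (negLaw p) = entropy p :=
  entropy_map_of_injective hp neg_injective

/-- The convolution is a mixture of translates of `q`, so this is concavity plus translation
invariance. -/
lemma entropy_le_entropy_add_left {p q : PMF G} (hp : p.support.Finite) (hq : q.support.Finite) :
    entropy q ≤ entropy (p + q) := by
  have h := expect_entropy_le_entropy_bind hp (support_add_finite hp hq)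
  simp only [entropy_map_of_injective hq (add_right_injective _), expect_const hp] at h
  exact h

lemma entropy_le_entropy_add_right {p q : PMF G} (hp : p.support.Finite) (hq : q.support.Finite) :
    entropy p ≤ entropy (p + q) := by
  rw [add_comm]
  exact entropy_le_entropy_add_left hq hp

lemma ruzsaDist_eq (p q : PMF G) :
    ruzsaDist p q = entropy (p + negLaw q) - entropy p / 2 - entropy q / 2 := by
  rw [ruzsaDist, indepSub_eq]

lemma entropy_add_negLaw_comm {p q : PMF G} (hp : p.support.Finite) (hq : q.support.Finite) :
    entropy (p + negLaw q) = entropy (q + negLaw p) := by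
  rw [← entropy_negLaw (support_add_finite hp (support_negLaw_finite hq)), map_add,
    negLaw_negLaw, add_comm]

lemma abs_entropy_sub_le {p q : PMF G} (hp : p.support.Finite) (hq : q.support.Finite) :
    |entropy p - entropy q| ≤ 2 * ruzsaDist p q := by
  have h1 := entropy_le_entropy_add_right hp (support_negLaw_finite hq)
  have h2 := entropy_le_entropy_add_left hp (support_negLaw_finite hq)
  rw [entropy_negLaw hq] at h2
  rw [ruzsaDist_eq, abs_le]
  constructor <;> linarith

lemma ruzsaDist_nonneg {p q : PMF G} (hp : p.support.Finite) (hq : q.support.Finite) :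
    0 ≤ ruzsaDist p q := by
  linarith [abs_entropy_sub_le hp hq, abs_nonneg (entropy p - entropy q)]

/-- The conditional laws of `X` given the sum `X + R` of independent variables. -/
lemma exists_conditional_add {p r : PMF G} (hp : p.support.Finite) (hr : r.support.Finite) :
    ∃ κ : G → PMF G,
      ((p + r).bind fun s => (κ s).map fun x => (x, s)) =
        (p.bind fun x => r.map fun t => (x, x + t)) ∧
      (∀ s, (κ s).support ⊆ p.support) ∧
      (p + r).bind κ = p ∧
      entropy (p + r) + (expect (p + r) fun s => entropy (κ s)) = entropy p + entropy r := by
  obtain ⟨κ, h1, h2⟩ := exists_disintegration (p.bind fun x => r.map fun t => (x, x + t))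
  have hsnd : (p.bind fun x => r.map fun t => (x, x + t)).map Prod.snd = p + r := by
    rw [PMF.map_bind]
    simp only [PMF.map_comp]
    rfl
  have hfst : (p.bind fun x => r.map fun t => (x, x + t)).map Prod.fst = p := by
    simp [PMF.map, PMF.bind_bind, Function.comp_def]
  rw [hsnd] at h1
  rw [hfst] at h2
  have hκ : ∀ s, (κ s).support.Finite := fun s => hp.subset (h2 s)
  have hpr := support_add_finite hp hr
  refine ⟨κ, h1, h2, ?_, ?_⟩
  · conv_rhs => rw [← hfst, ← h1]
    simp [PMF.map, PMF.bind_bind, Function.comp_def]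
  · have e1 : entropy (p.bind fun x => r.map fun t => (x, x + t)) = entropy p + entropy r := by
      rw [← entropy_prod hp hr, ← entropy_map_of_injective (p := p.bind fun x => r.map fun t => (x, t))
        (f := fun z : G × G => (z.1, z.1 + z.2))
        (support_bind_finite hp fun _ => support_map_finite hr _), PMF.map_bind]
      · simp only [PMF.map_comp, Function.comp_def]
      · rintro ⟨a, b⟩ ⟨c, d⟩ h
        simp only [Prod.mk.injEq] at h
        obtain ⟨rfl, h⟩ := h
        simpa using h
    rw [← e1, ← h1, entropy_bind_of_fibers hpr
      (support_bind_finite hpr fun s => support_map_finite (hκ s) _) Prod.snd]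
    · have : ∀ s, entropy ((κ s).map fun x => (x, s)) = entropy (κ s) := fun s =>
        entropy_map_of_injective (hκ s) fun a b h => (Prod.ext_iff.1 h).1
      simp only [this]
    · intro s _ z hz
      obtain ⟨y, _, rfl⟩ := (PMF.mem_support_map_iff _ _ _).1 hz
      rfl

/-- The fibring inequality for the sum map, in terms of conditional laws `κ s`, `κ' s'`. -/
lemma fibring_inequality {p q r t : PMF G} (hp : p.support.Finite) (hq : q.support.Finite)
    (hr : r.support.Finite) (ht : t.support.Finite) {κ κ' : G → PMF G}
    (hκ : ((p + r).bind fun s => (κ s).map fun x => (x, s)) =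
      (p.bind fun x => r.map fun t => (x, x + t)))
    (hκ' : ((q + t).bind fun s => (κ' s).map fun x => (x, s)) =
      (q.bind fun x => t.map fun t => (x, x + t)))
    (hκs : ∀ s, (κ s).support.Finite) (hκs' : ∀ s, (κ' s).support.Finite) :
    entropy (indepSub (p + r) (q + t)) +
      (expect ((p + r).bind fun s => (q + t).map fun s' => (s, s')) fun z =>
        entropy (indepSub (κ z.1) (κ' z.2))) ≤
      entropy (indepSub p q) + entropy (indepSub r t) := by
  have hpr := support_add_finite hp hr
  have hqt := support_add_finite hq ht
  have hpq := support_indepSub_finite hp hq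
  have hrt := support_indepSub_finite hr ht
  -- Condition on the pair of sums but retain only their difference: the loss of information is the
  -- whole source of the inequality.
  have key := entropy_map_add_expect_le
    (p := (p + r).bind fun s => (q + t).map fun s' => (s, s'))
    (support_bind_finite hpr fun _ => support_map_finite hqt _)
    (F := fun z => indepSub (κ z.1) (κ' z.2))
    (fun z => support_indepSub_finite (hκs _) (hκs' _)) (fun z => z.1 - z.2)
  have e1 : ((p + r).bind fun s => (q + t).map fun s' => (s, s')).map (fun z => z.1 - z.2) =
      indepSub (p + r) (q + t) := by
    rw [PMF.map_bind]
    simp only [PMF.map_comp]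
    rfl
  -- The shear (x, y) ↦ (x, x + y) carries the independent pair (X - Y, R - T) to (X - Y, (X + R) -
  -- (Y + T)).
  have e2 : entropy (indepSub p q) + entropy (indepSub r t) =
      entropy ((indepSub p q).bind fun x => (indepSub r t).map fun y => (x, x + y)) := by
    rw [← entropy_prod hpq hrt, ← entropy_map_of_injective
      (p := (indepSub p q).bind fun x => (indepSub r t).map fun y => (x, y)) (f := fun z : G × G => (z.1, z.1 + z.2))
      (support_bind_finite hpq fun _ => support_map_finite hrt _), PMF.map_bind]
    · simp only [PMF.map_comp, Function.comp_def]
    · rintro ⟨a, b⟩ ⟨c, d⟩ h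
      simp only [Prod.mk.injEq] at h
      obtain ⟨rfl, h⟩ := h
      simpa using h
  have e3 : (((p + r).bind fun s => (q + t).map fun s' => (s, s')).bind fun z =>
        (indepSub (κ z.1) (κ' z.2)).map fun a => (a, z.1 - z.2)) =
      (indepSub p q).bind fun x => (indepSub r t).map fun y => (x, x + y) := by
    have c1 : ∀ h : G × G → PMF (G × G), ((p + r).bind fun s => (κ s).bind fun x => h (x, s)) =
        p.bind fun x => r.bind fun t => h (x, x + t) := by
      intro h
      have := congrArg (fun μ => PMF.bind μ h) hκ
      simpa [PMF.bind_bind, PMF.bind_map, Function.comp_def] using this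
    have c2 : ∀ h : G × G → PMF (G × G), ((q + t).bind fun s => (κ' s).bind fun x => h (x, s)) =
        q.bind fun x => t.bind fun t => h (x, x + t) := by
      intro h
      have := congrArg (fun μ => PMF.bind μ h) hκ'
      simpa [PMF.bind_bind, PMF.bind_map, Function.comp_def] using this
    simp only [indepSub, ← PMF.bind_pure_comp, PMF.bind_bind, Function.comp_def, PMF.pure_bind]
    calc _ = (p + r).bind fun s => (κ s).bind fun x => (q + t).bind fun s' => (κ' s').bind
          fun y => PMF.pure (x - y, s - s') := by
          congr 1
          ext1 s
          rw [PMF.bind_comm]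
      _ = p.bind fun x => r.bind fun a => q.bind fun y => t.bind fun b =>
          PMF.pure (x - y, x + a - (y + b)) := by
          rw [c1 fun z => (q + t).bind fun s' => (κ' s').bind
            fun y => PMF.pure (z.1 - y, z.2 - s')]
          congr 1
          ext1 x
          congr 1
          ext1 a
          exact c2 fun z => PMF.pure (x - z.1, x + a - z.2)
      _ = _ := by
          congr 1
          ext1 x
          rw [PMF.bind_comm]
          simp only [add_sub_add_comm]
  rw [e1, e3] at key
  rw [e2]
  exact key

/-- Adding independent copies of the variables of a minimizer does not increase Ruzsa distances
by much. -/
lemma ruzsaDist_add_le {p q u r t : PMF G} {S : Set G} (hS : S.Finite) (hp : p.support ⊆ S)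
    (hq : q.support ⊆ S) (hu : u.support.Finite) (hr : r.support.Finite) (ht : t.support.Finite)
    {e : ℝ} (he : 0 ≤ e)
    (hmin : ∀ p' q' : PMF G, p'.support ⊆ S → q'.support ⊆ S →
      ruzsaDist p q + e * (ruzsaDist p u + ruzsaDist q u) ≤
        ruzsaDist p' q' + e * (ruzsaDist p' u + ruzsaDist q' u)) :
    ruzsaDist (p + r) (q + t) ≤ ruzsaDist r t +
      e / 2 * (entropy (p + r) - entropy r + (entropy (q + t) - entropy t)) := by
  have hpf := hS.subset hp
  have hqf := hS.subset hq
  obtain ⟨κ, h1, h2, h3, h4⟩ := exists_conditional_add hpf hr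
  obtain ⟨κ', h1', h2', h3', h4'⟩ := exists_conditional_add hqf ht
  have hκ : ∀ s, (κ s).support.Finite := fun s => hpf.subset (h2 s)
  have hκ' : ∀ s, (κ' s).support.Finite := fun s => hqf.subset (h2' s)
  have fib := fibring_inequality hpf hqf hr ht h1 h1' hκ hκ'
  have hpr := support_add_finite hpf hr
  have hqt := support_add_finite hqf ht
  have hπ : ((p + r).bind fun s => (q + t).map fun s' => (s, s')).support.Finite :=
    support_bind_finite hpr fun _ => support_map_finite hqt _
  have hfst : ((p + r).bind fun s => (q + t).map fun s' => (s, s')).map Prod.fst = p + r := by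
    simp [PMF.map, PMF.bind_bind, Function.comp_def]
  have hsnd : ((p + r).bind fun s => (q + t).map fun s' => (s, s')).map Prod.snd = q + t := by
    simp [PMF.map, PMF.bind_bind, Function.comp_def]
  have hu1 : (expect (p + r) fun s => entropy (indepSub (κ s) u)) ≤ entropy (indepSub p u) := by
    have e : indepSub p u = (p + r).bind fun s => indepSub (κ s) u := by
      conv_lhs => rw [← h3]
      simp [indepSub, PMF.bind_bind]
    have hf : ((p + r).bind fun s => indepSub (κ s) u).support.Finite :=
      support_bind_finite hpr fun s => support_indepSub_finite (hκ s) hu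
    rw [e]
    exact expect_entropy_le_entropy_bind hpr hf
  have hu2 : (expect (q + t) fun s => entropy (indepSub (κ' s) u)) ≤ entropy (indepSub q u) := by
    have e : indepSub q u = (q + t).bind fun s => indepSub (κ' s) u := by
      conv_lhs => rw [← h3']
      simp [indepSub, PMF.bind_bind]
    have hf : ((q + t).bind fun s => indepSub (κ' s) u).support.Finite :=
      support_bind_finite hqt fun s => support_indepSub_finite (hκ' s) hu
    rw [e]
    exact expect_entropy_le_entropy_bind hqt hf
  set π := (p + r).bind fun s => (q + t).map fun s' => (s, s') with hπdef
  -- The conditional laws are supported in `S`, hence are admissible competitors; minimality is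
  -- averaged over independent values of the two sums.
  have avg := expect_mono hπ (fun z _ =>
    hmin (κ z.1) (κ' z.2) ((h2 _).trans hp) ((h2' _).trans hq))
  have hform : (fun z : G × G => ruzsaDist (κ z.1) (κ' z.2) +
      e * (ruzsaDist (κ z.1) u + ruzsaDist (κ' z.2) u)) = fun z =>
      entropy (indepSub (κ z.1) (κ' z.2)) +
        ((e * entropy (indepSub (κ z.1) u) + e * entropy (indepSub (κ' z.2) u)) +
        (((-(1 + e) / 2) * entropy (κ z.1) + (-(1 + e) / 2) * entropy (κ' z.2)) +
          (-e * entropy u))) := by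
    funext z
    simp only [ruzsaDist]
    ring
  have E1 : ∀ g : G → ℝ, (expect π fun z => g z.1) = expect (p + r) g := fun g => by
    rw [← hfst, expect_map hπ]
  have E2 : ∀ g : G → ℝ, (expect π fun z => g z.2) = expect (q + t) g := fun g => by
    rw [← hsnd, expect_map hπ]
  rw [hform, expect_const hπ] at avg
  simp only [expect_add hπ, expect_const_mul, expect_const hπ,
    E1 fun s => entropy (indepSub (κ s) u), E2 fun s => entropy (indepSub (κ' s) u),
    E1 fun s => entropy (κ s), E2 fun s => entropy (κ' s)] at avg
  -- The chain rule turns the mean conditional entropies into H(p) + H(r) - H(p + r) and its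
  -- analogue for q, t. Their coefficient -(1+e)/2 is what leaves the e/2 error terms.
  rw [eq_sub_of_add_eq' h4, eq_sub_of_add_eq' h4'] at avg
  have m1 := mul_le_mul_of_nonneg_left hu1 he
  have m2 := mul_le_mul_of_nonneg_left hu2 he
  simp only [ruzsaDist] at avg ⊢
  linarith

end Group

/-! ### Growth of a minimizer -/

section Growth

variable {G : Type u} [AddCommGroup G]

/-- Ruzsa distance corrected by a multiple of the entropies. -/
def reducedDist (e : ℝ) (p q : PMF G) : ℝ :=
  ruzsaDist p q - e / 2 * (entropy p + entropy q)

lemma reducedDist_negLaw (e : ℝ) {p q : PMF G} (hp : p.support.Finite) (hq : q.support.Finite) :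
    reducedDist e (negLaw p) (negLaw q) = reducedDist e p q := by
  rw [reducedDist, reducedDist, ruzsaDist_eq, ruzsaDist_eq, ← map_add,
    entropy_negLaw (support_add_finite hp (support_negLaw_finite hq)), entropy_negLaw hp,
    entropy_negLaw hq]

lemma reducedDist_comm (e : ℝ) {p q : PMF G} (hp : p.support.Finite) (hq : q.support.Finite) :
    reducedDist e p q = reducedDist e q p := by
  rw [reducedDist, reducedDist, ruzsaDist_eq, ruzsaDist_eq, entropy_add_negLaw_comm hp hq]
  ring

/-- If adding `p` and `q` does not increase the reduced distance, then the reduced distance of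
`nX - nY` and `nY - nX` is at most that of `X` and `Y`. -/
lemma reducedDist_nsmul_le {e : ℝ} {p q : PMF G} (hp : p.support.Finite) (hq : q.support.Finite)
    (hstep : ∀ r t : PMF G, r.support.Finite → t.support.Finite →
      reducedDist e (p + r) (q + t) ≤ reducedDist e r t) (n : ℕ) :
    reducedDist e ((n + 1) • (p + negLaw q)) (negLaw ((n + 1) • (p + negLaw q))) ≤
      reducedDist e p q := by
  have hD : (p + negLaw q).support.Finite := support_add_finite hp (support_negLaw_finite hq)
  have hnD : ∀ m : ℕ, (m • (p + negLaw q)).support.Finite := support_nsmul_finite hD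
  -- The reduced distance is unchanged under (r, t) ↦ (-t, -r), so X and Y may also be added after
  -- this exchange.
  have swap : ∀ r t : PMF G, r.support.Finite → t.support.Finite →
      reducedDist e (p + negLaw t) (q + negLaw r) ≤ reducedDist e r t := by
    intro r t hr ht
    refine (hstep _ _ (support_negLaw_finite ht) (support_negLaw_finite hr)).trans ?_
    rw [reducedDist_negLaw e ht hr, reducedDist_comm e ht hr]
  -- Exchanging (X + mD, Y - mD) and then adding X and Y gives ((m+1)D, -(m+1)D).
  have fwd : ∀ m : ℕ, reducedDist e ((m + 1) • (p + negLaw q)) (negLaw ((m + 1) • (p + negLaw q))) ≤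
      reducedDist e (p + m • (p + negLaw q)) (q + negLaw (m • (p + negLaw q))) := by
    intro m
    refine le_trans (le_of_eq ?_) (swap _ _ (support_add_finite hp (hnD m))
      (support_add_finite hq (support_negLaw_finite (hnD m))))
    congr 1
    · rw [map_add, negLaw_negLaw, succ_nsmul']
      abel
    · rw [map_add, succ_nsmul', map_add, map_add, negLaw_negLaw]
      abel
  have base : ∀ m : ℕ, reducedDist e (p + m • (p + negLaw q)) (q + negLaw (m • (p + negLaw q))) ≤
      reducedDist e p q := by
    intro m
    induction m with
    | zero => simp
    | succ m ih =>
      exact ((hstep _ _ (hnD _) (support_negLaw_finite (hnD _))).trans (fwd m)).trans ih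
  exact (fwd n).trans (base n)

/-- The entropy of `2 ^ j` copies of `X - Y`, for a minimizer `(X, Y)`. -/
lemma entropy_two_pow_nsmul_le {e : ℝ} (he : 0 ≤ e) {p q : PMF G} (hp : p.support.Finite)
    (hq : q.support.Finite)
    (hstep : ∀ r t : PMF G, r.support.Finite → t.support.Finite →
      reducedDist e (p + r) (q + t) ≤ reducedDist e r t) (j : ℕ) :
    entropy (2 ^ j • (p + negLaw q)) ≤
      (entropy p + entropy q) / 2 + ruzsaDist p q * (j + 1) * (1 + e) ^ j := by
  have hD : (p + negLaw q).support.Finite := support_add_finite hp (support_negLaw_finite hq)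
  have hk := ruzsaDist_nonneg hp hq
  induction j with
  | zero =>
    rw [pow_zero, one_nsmul, ruzsaDist_eq]
    apply le_of_eq
    push_cast
    ring
  | succ j ih =>
    have hDj := support_nsmul_finite hD (2 ^ j)
    -- With Z = 2^j D this reads H(2Z) ≤ (1+e) H(Z) + k - (e/2)(H(X) + H(Y)).
    have h := reducedDist_nsmul_le hp hq hstep (2 ^ j - 1)
    rw [Nat.sub_add_cancel Nat.one_le_two_pow, reducedDist, reducedDist, ruzsaDist_eq,
      negLaw_negLaw, ← two_nsmul, ← mul_nsmul', ← pow_succ', entropy_negLaw hDj] at h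
    have h1 : 1 ≤ (1 + e) ^ (j + 1) := one_le_pow₀ (by linarith)
    have h2 := mul_le_mul_of_nonneg_left ih (by linarith : 0 ≤ 1 + e)
    have h3 := mul_le_mul_of_nonneg_left h1 hk
    have h4 : ruzsaDist p q * ((j + 1 : ℕ) + 1 : ℝ) * (1 + e) ^ (j + 1) =
        (1 + e) * (ruzsaDist p q * (j + 1) * (1 + e) ^ j) + ruzsaDist p q * (1 + e) ^ (j + 1) := by
      push_cast
      ring
    rw [h4]
    linarith

/-- Logarithmic growth of the entropies `H(nX)` for `log n` up to the order of `1 / e`. -/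
lemma entropy_nsmul_le {e : ℝ} (he : 0 ≤ e) {p q : PMF G} (hp : p.support.Finite)
    (hq : q.support.Finite)
    (hstep : ∀ r t : PMF G, r.support.Finite → t.support.Finite →
      reducedDist e (p + r) (q + t) ≤ reducedDist e r t) {n : ℕ} (hn : 0 < n)
    (hne : e * (3 * Real.log n) ≤ 1) :
    entropy (n • p) ≤ entropy p + 18 * ruzsaDist p q * Real.log n := by
  have hk := ruzsaDist_nonneg hp hq
  -- For n = 1 the logarithm vanishes and cannot absorb the rounding of log₂ n to an integer.
  obtain rfl | hn2 : n = 1 ∨ 2 ≤ n := by omega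
  · simp
  set j := Nat.clog 2 n with hj
  have hnj : n ≤ 2 ^ j := Nat.le_pow_clog one_lt_two n
  have hjn : 2 ^ (j - 1) < n := Nat.pow_pred_clog_lt_self one_lt_two (by omega)
  have hj1 : 1 ≤ j := Nat.clog_pos one_lt_two hn2
  have hl2 := Real.log_two_gt_d9
  have hn2' : Real.log 2 ≤ Real.log n := Real.log_le_log (by norm_num) (by exact_mod_cast hn2)
  have hjlog : ((j : ℝ) - 1) * Real.log 2 ≤ Real.log n := by
    have : Real.log ((2 : ℝ) ^ (j - 1)) ≤ Real.log n :=
      Real.log_le_log (by positivity) (by exact_mod_cast hjn.le)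
    rwa [Real.log_pow, Nat.cast_sub hj1, Nat.cast_one] at this
  have hj3 : (j : ℝ) ≤ 3 * Real.log n := by
    by_contra! h
    nlinarith
  -- Here j + 2 ≤ log n / log 2 + 3 ≤ 4 log n / log 2, and 4 / log 2 < 6.
  have hj6 : (j : ℝ) + 2 ≤ 6 * Real.log n := by
    by_contra! h
    nlinarith
  have hpow : (1 + e) ^ j ≤ 3 := by
    calc (1 + e) ^ j ≤ Real.exp e ^ j := by
          gcongr
          linarith [Real.add_one_le_exp e]
      _ = Real.exp (j * e) := (Real.exp_nat_mul e j).symm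
      _ ≤ Real.exp 1 := by
          apply Real.exp_le_exp.2
          nlinarith
      _ ≤ 3 := by linarith [Real.exp_one_lt_d9]
  have hD : (p + negLaw q).support.Finite := support_add_finite hp (support_negLaw_finite hq)
  have m1 : entropy (n • p) ≤ entropy (n • (p + negLaw q)) := by
    rw [nsmul_add]
    exact entropy_le_entropy_add_right (support_nsmul_finite hp n)
      (support_nsmul_finite (support_negLaw_finite hq) n)
  have m2 : entropy (n • (p + negLaw q)) ≤ entropy (2 ^ j • (p + negLaw q)) := by
    rw [← Nat.add_sub_of_le hnj, add_nsmul]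
    exact entropy_le_entropy_add_right (support_nsmul_finite hD n) (support_nsmul_finite hD _)
  have m3 := entropy_two_pow_nsmul_le he hp hq hstep j
  -- This gives (H(X) + H(Y))/2 ≤ H(X) + k, so the total excess is at most k(1 + 3(j+1)) ≤ 3k(j+2) ≤
  -- 18 k log n.
  have m4 := (abs_le.1 (abs_entropy_sub_le hp hq)).1
  have m5 : ruzsaDist p q * (j + 1) * (1 + e) ^ j ≤ ruzsaDist p q * (j + 1) * 3 := by gcongr
  have m6 := mul_le_mul_of_nonneg_left hj6 hk
  nlinarith

end Growth

/-! ### The trivial bound for the minimum, and numerical estimates -/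

/-- Ruzsa's triangle inequality gives |A - A| ≤ K²|A|, and the entropy of a difference is at most
log |A - A|. -/
lemma ruzsaDist_uniformOfFinset_self_le {G : Type u} [AddCommGroup G] [DecidableEq G]
    (A : Finset G) (hA : A.Nonempty) {K : ℝ} (hK : ((A + A).card : ℝ) ≤ K * (A.card : ℝ)) :
    ruzsaDist (PMF.uniformOfFinset A hA) (PMF.uniformOfFinset A hA) ≤ 2 * Real.log K := by
  have hc : (0 : ℝ) < A.card := by exact_mod_cast hA.card_pos
  have hd : (0 : ℝ) < (A - A).card := by exact_mod_cast (hA.sub hA).card_pos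
  have hK0 : 0 < K := by
    have : (0 : ℝ) < (A + A).card := by exact_mod_cast (hA.add hA).card_pos
    exact pos_of_mul_pos_left (this.trans_le hK) hc.le
  have tri : ((A - A).card : ℝ) * A.card ≤ (A + A).card * (A + A).card := by
    exact_mod_cast Finset.ruzsa_triangle_inequality_sub_add_add A A A
  have h2 : ((A - A).card : ℝ) ≤ K ^ 2 * A.card := by
    have h3 : ((A + A).card : ℝ) * (A + A).card ≤ (K * A.card) * (K * A.card) := by gcongr
    refine le_of_mul_le_mul_right ((tri.trans h3).trans (le_of_eq ?_)) hc
    ring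
  have hsupp : (indepSub (PMF.uniformOfFinset A hA) (PMF.uniformOfFinset A hA)).support ⊆
      ((A - A : Finset G) : Set G) := by
    intro x hx
    obtain ⟨a, ha, hx⟩ := (PMF.mem_support_bind_iff _ _ _).1 hx
    obtain ⟨b, hb, rfl⟩ := (PMF.mem_support_map_iff _ _ _).1 hx
    rw [PMF.mem_support_uniformOfFinset_iff] at ha hb
    exact Finset.mem_coe.2 (Finset.sub_mem_sub ha hb)
  have h4 := entropy_le_log_card hsupp
  have h5 : Real.log ((A - A).card : ℝ) ≤ Real.log (K ^ 2 * A.card) := Real.log_le_log hd h2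
  rw [Real.log_mul (by positivity) hc.ne', Real.log_pow] at h5
  push_cast at h5
  rw [ruzsaDist, entropy_uniformOfFinset]
  linarith

/-- The margin above 1 keeps log₃(16K) bounded away from zero even at K = 1. The bound log x ≥ 1 -
1/x at x = log 16 / exp 1 is sharp enough. -/
lemma le_log₂_sixteen : 1.019 ≤ log₂ 16 := by
  have h16 : Real.log 16 = 4 * Real.log 2 := by
    rw [show (16 : ℝ) = 2 ^ 4 by norm_num, Real.log_pow]
    norm_num
  have hl := Real.log_two_gt_d9
  have he := Real.exp_one_lt_d9
  have hpos : (0 : ℝ) < Real.log 16 := by rw [h16]; linarith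
  have h1 := Real.one_sub_inv_le_log_of_pos (x := Real.log 16 / Real.exp 1) (by positivity)
  rw [Real.log_div hpos.ne' (Real.exp_ne_zero _), Real.log_exp, inv_div] at h1
  have h2 : Real.exp 1 / Real.log 16 ≤ 0.981 := by
    rw [div_le_iff₀ hpos, h16]
    linarith
  rw [log₂]
  linarith

/-- Numerical bounds for the iterated logarithms. -/
lemma iterated_log_bounds {K : ℝ} (hK : 1 ≤ K) :
    1 ≤ Real.log (16 * K) ∧ 1 ≤ log₂ (16 * K) ∧ 1 / 100 ≤ log₃ (16 * K) ∧
      log₃ (16 * K) ≤ log₂ (16 * K) := by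
  have h16 : Real.log 16 = 4 * Real.log 2 := by
    rw [show (16 : ℝ) = 2 ^ 4 by norm_num, Real.log_pow]
    norm_num
  have hl := Real.log_two_gt_d9
  have h1 : Real.log 16 ≤ Real.log (16 * K) := Real.log_le_log (by norm_num) (by linarith)
  have h2 : log₂ 16 ≤ log₂ (16 * K) := Real.log_le_log (by linarith) h1
  have h3 := le_log₂_sixteen
  have h4 : 1.019 ≤ log₂ (16 * K) := h3.trans h2
  have h5 := Real.one_sub_inv_le_log_of_pos (x := log₂ (16 * K)) (by linarith)
  have h6 : (log₂ (16 * K))⁻¹ ≤ 0.99 := by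
    rw [inv_le_comm₀ (by linarith) (by norm_num)]
    exact le_trans (by norm_num) h4
  have h7 := Real.log_le_sub_one_of_pos (x := log₂ (16 * K)) (by linarith)
  refine ⟨by linarith, by linarith, ?_, ?_⟩
  · change 1 / 100 ≤ Real.log (log₂ (16 * K))
    linarith
  · change Real.log (log₂ (16 * K)) ≤ _
    linarith

lemma log_thousand_le : Real.log 1000 ≤ 7 := by
  have h1 : Real.log 1000 ≤ Real.log (2 ^ 10) := Real.log_le_log (by norm_num) (by norm_num)
  rw [Real.log_pow] at h1
  have := Real.log_two_lt_d9
  push_cast at h1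
  linarith

/-- The scale `C d ^ 5` has logarithm `O(log₂ (16 K))`. -/
lemma log_scale_le {C K : ℝ} (hK : 1 ≤ K) (hb : Real.log (max C 1) + 35 ≤ log₃ (16 * K)) {n : ℕ}
    (hn : 0 < n)
    (hnC : (n : ℝ) ≤ C * (1000 * (Real.log (16 * K) * log₃ (16 * K))) ^ 5) :
    Real.log n ≤ 11 * log₂ (16 * K) := by
  obtain ⟨hL, ha, hb0, hba⟩ := iterated_log_bounds hK
  have hC1 : 0 < max C 1 := by positivity
  have hC0 : 0 ≤ Real.log (max C 1) := Real.log_nonneg (le_max_right _ _)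
  have hn0 : (0 : ℝ) < n := by exact_mod_cast hn
  have hd : 0 < 1000 * (Real.log (16 * K) * log₃ (16 * K)) := by positivity
  have h1 : (n : ℝ) ≤ max C 1 * (1000 * (Real.log (16 * K) * log₃ (16 * K))) ^ 5 :=
    hnC.trans (by gcongr; exact le_max_left _ _)
  have h2 := Real.log_le_log hn0 h1
  have hbp : 0 < log₃ (16 * K) := by linarith
  rw [Real.log_mul hC1.ne' (by positivity), Real.log_pow, Real.log_mul (by norm_num)
    (by positivity), Real.log_mul (by positivity) hbp.ne'] at h2
  -- With a = log₂(16K) and b = log₃(16K): log n ≤ log (max C 1) + 35 + 5a + 5b ≤ 5a + 6b ≤ 11a,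
  -- where 35 = 5 · 7 covers 5 log 1000.
  have h3 := Real.log_le_sub_one_of_pos hbp
  have h4 := log_thousand_le
  change _ ≤ 11 * Real.log (Real.log (16 * K))
  change _ ≤ Real.log (Real.log (16 * K)) at hba
  push_cast at h2
  linarith

lemma one_le_of_card_add_le {G : Type u} [AddCommGroup G] [DecidableEq G] {A : Finset G}
    (hA : A.Nonempty) {K : ℝ} (hK : ((A + A).card : ℝ) ≤ K * (A.card : ℝ)) : 1 ≤ K := by
  have hc : (0 : ℝ) < A.card := by exact_mod_cast hA.card_pos
  have h : (A.card : ℝ) ≤ (A + A).card := by exact_mod_cast Finset.card_le_card_add_right hA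
  exact le_of_mul_le_mul_right (by linarith) hc

/-- Bounds for the distances between a minimizer of `τ` and the uniform law. -/
lemma IsTauMinimizer.bounds {G : Type u} [AddCommGroup G] [DecidableEq G] {A : Finset G}
    {hA : A.Nonempty} {K : ℝ} (hK : ((A + A).card : ℝ) ≤ K * (A.card : ℝ)) {X Y : PMF G}
    (h : IsTauMinimizer A hA K X Y) :
    ruzsaDist X Y ≤ 3 * Real.log (16 * K) ∧
      ruzsaDist X (PMF.uniformOfFinset A hA) ≤
        3027 * Real.log (16 * K) * (log₂ (16 * K) * log₃ (16 * K)) := by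
  have hK1 := one_le_of_card_add_le hA hK
  obtain ⟨hL, ha, hb, -⟩ := iterated_log_bounds hK1
  have hXf := A.finite_toSet.subset h.1
  have hYf := A.finite_toSet.subset h.2.1
  have hUs : (PMF.uniformOfFinset A hA).support ⊆ (A : Set G) := by simp
  have hUf := A.finite_toSet.subset hUs
  have hmin := h.2.2 _ _ hUs hUs
  have hUU := ruzsaDist_uniformOfFinset_self_le A hA hK
  have hlogK : 0 ≤ Real.log K := Real.log_nonneg hK1
  have hlogL : Real.log K ≤ Real.log (16 * K) :=
    Real.log_le_log (by linarith) (by linarith)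
  have h1 := ruzsaDist_nonneg hXf hYf
  have h2 := ruzsaDist_nonneg hXf hUf
  have h3 := ruzsaDist_nonneg hYf hUf
  simp only [tau] at hmin
  set w := log₂ (16 * K) * log₃ (16 * K) with hw
  have hw1 : 1 / 100 ≤ w := by nlinarith
  have hwp : 0 < w := by linarith
  set e := (1 / 1009 : ℝ) / w with he
  have hep : 0 < e := by positivity
  have hew : e * w = 1 / 1009 := div_mul_cancel₀ _ hwp.ne'
  have he1 : e ≤ 1 / 10 := by
    rw [he, div_le_iff₀ hwp]
    linarith
  -- The left side is at most (1 + 2e) · 2 log K, and e ≤ 1/10.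
  have hUU' : ruzsaDist (PMF.uniformOfFinset A hA) (PMF.uniformOfFinset A hA) +
      e * (ruzsaDist (PMF.uniformOfFinset A hA) (PMF.uniformOfFinset A hA) +
        ruzsaDist (PMF.uniformOfFinset A hA) (PMF.uniformOfFinset A hA)) ≤
      3 * Real.log (16 * K) := by
    nlinarith
  have hmin' := hmin.trans hUU'
  have h4 : e * ruzsaDist X (PMF.uniformOfFinset A hA) ≤ 3 * Real.log (16 * K) := by
    nlinarith [mul_nonneg hep.le h3]
  refine ⟨by nlinarith [mul_nonneg hep.le (add_nonneg h2 h3)], ?_⟩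
  -- Multiplying by w clears the denominator of e; 3027 = 3 · 1009.
  have h5 := mul_le_mul_of_nonneg_right h4 hwp.le
  have h6 : e * ruzsaDist X (PMF.uniformOfFinset A hA) * w =
      1 / 1009 * ruzsaDist X (PMF.uniformOfFinset A hA) := by
    rw [← hew]
    ring
  linarith

/-- The law of `X` in a minimizing pair `(X, Y)` has logarithmic entropy growth. -/
lemma IsTauMinimizer.hasPolynomialGrowth {G : Type u} [AddCommGroup G] [DecidableEq G]
    {A : Finset G} {hA : A.Nonempty} {K C : ℝ} (hK : ((A + A).card : ℝ) ≤ K * (A.card : ℝ))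
    {X Y : PMF G} (h : IsTauMinimizer A hA K X Y)
    (hb : Real.log (max C 1) + 35 ≤ log₃ (16 * K)) :
    HasPolynomialGrowth X (1000 * (Real.log (16 * K) * log₃ (16 * K)))
      (C * (1000 * (Real.log (16 * K) * log₃ (16 * K))) ^ 5) := by
  intro n hn hnC
  have hK1 := one_le_of_card_add_le hA hK
  obtain ⟨hL, ha, -, -⟩ := iterated_log_bounds hK1
  have hC0 : 0 ≤ Real.log (max C 1) := Real.log_nonneg (le_max_right _ _)
  have hb35 : 35 ≤ log₃ (16 * K) := by linarith
  have hXf := A.finite_toSet.subset h.1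
  have hYf := A.finite_toSet.subset h.2.1
  have hUs : (PMF.uniformOfFinset A hA).support ⊆ (A : Set G) := by simp
  have hlog := log_scale_le hK1 hb hn hnC
  have hk := (h.bounds hK).1
  have hmin := h.2.2
  simp only [tau] at hmin
  set e := (1 / 1009 : ℝ) / (log₂ (16 * K) * log₃ (16 * K)) with he
  have hep : 0 ≤ e := by positivity
  have hstep : ∀ r t : PMF G, r.support.Finite → t.support.Finite →
      reducedDist e (X + r) (Y + t) ≤ reducedDist e r t := by
    intro r t hr ht
    have := ruzsaDist_add_le A.finite_toSet h.1 h.2.1 (A.finite_toSet.subset hUs) hr ht hep hmin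
    rw [reducedDist, reducedDist]
    linarith
  -- Since log n ≤ 11 log₂(16K), the left side is at most 33 / (1009 log₃(16K)).
  have hne : e * (3 * Real.log n) ≤ 1 := by
    rw [he, div_mul_eq_mul_div, div_le_one (by positivity)]
    nlinarith
  rw [iidSum_eq_nsmul]
  refine (entropy_nsmul_le hep hXf hYf hstep hn hne).trans ?_
  have hn0 : 0 ≤ Real.log n := Real.log_natCast_nonneg n
  have hcoef : 18 * ruzsaDist X Y ≤ 1000 * (Real.log (16 * K) * log₃ (16 * K)) := by nlinarith
  linarith [mul_le_mul_of_nonneg_right hcoef hn0]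

/-- The main distance bound in terms of `d = 1000 log (16 K) log₃ (16 K)`. -/
lemma mul_iterated_log_le {K : ℝ} (hK : 1 ≤ K) :
    3027 * Real.log (16 * K) * (log₂ (16 * K) * log₃ (16 * K)) ≤
      30 * (1000 * (Real.log (16 * K) * log₃ (16 * K))) *
        Real.log (1000 * (Real.log (16 * K) * log₃ (16 * K))) := by
  obtain ⟨hL, ha, hb, -⟩ := iterated_log_bounds hK
  -- Because log₃(16K) ≥ 1/100, the factor 1000 makes d at least log(16K), so log d ≥ log₂(16K).
  have h1 : log₂ (16 * K) ≤ Real.log (1000 * (Real.log (16 * K) * log₃ (16 * K))) :=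
    Real.log_le_log (by linarith) (by nlinarith)
  have h2 : 0 ≤ Real.log (16 * K) * log₃ (16 * K) := by positivity
  have h3 := mul_le_mul_of_nonneg_left h1 h2
  have h4 : 0 ≤ Real.log (16 * K) * log₃ (16 * K) * log₂ (16 * K) := by positivity
  linarith

end

end EntropicGrowth

/-- The absolute constant `c` and the order `d = d(K) = O(log(16K) log₃(16K))` do not depend on `C`,
and the bound `K₀` expressing `K = O_C(1)` depends on `C` only. -/
theorem proposition2p9 :
    ∃ (c : ℝ) (d : ℝ → ℝ), 0 < c ∧
      (∀ K : ℝ, 1 ≤ K → 0 < d K ∧ d K ≤ c * (Real.log (16 * K) * log₃ (16 * K))) ∧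
      ∀ C : ℝ, ∃ K₀ : ℝ,
        ∀ (G : Type u) [AddCommGroup G] [DecidableEq G] (A : Finset G) (hA : A.Nonempty) (K : ℝ),
          ((A + A).card : ℝ) ≤ K * (A.card : ℝ) →
          ∀ X Y : PMF G, IsTauMinimizer A hA K X Y →
            (K ≤ K₀ ∨ HasPolynomialGrowth X (d K) (C * d K ^ 5)) ∧
              ruzsaDist X (PMF.uniformOfFinset A hA) ≤ 30 * d K * Real.log (d K) := by
  -- The triple exponential makes log₃(16K) ≥ log (max C 1) + 35 once K > K₀; `max C 1` covers small
  -- or negative C.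
  refine ⟨1000, fun K => 1000 * (Real.log (16 * K) * log₃ (16 * K)), by norm_num,
    fun K hK => ⟨?_, le_rfl⟩, fun C => ⟨Real.exp (Real.exp (Real.exp (Real.log (max C 1) + 35))),
    fun G _ _ A hA K hK X Y h => ⟨?_, ?_⟩⟩⟩
  · obtain ⟨hL, ha, hb, -⟩ := iterated_log_bounds hK
    positivity
  · refine or_iff_not_imp_left.2 fun hK0 => h.hasPolynomialGrowth hK ?_
    have h0 := Real.exp_pos (Real.exp (Real.exp (Real.log (max C 1) + 35)))
    have h1 : Real.exp (Real.exp (Real.exp (Real.log (max C 1) + 35))) ≤ 16 * K := by linarith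
    have h2 := (Real.le_log_iff_exp_le (by linarith)).2 h1
    have h3 := (Real.le_log_iff_exp_le ((Real.exp_pos _).trans_le h2)).2 h2
    exact (Real.le_log_iff_exp_le ((Real.exp_pos _).trans_le h3)).2 h3
  · exact (h.bounds hK).2.trans (mul_iterated_log_le (one_le_of_card_add_le hA hK))
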